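/- **Theorem A.** Let $X$ be a dendrite, that is, a (non-empty) compact connected and locally connected metric space that contains no homeomorphic copy of the circle. Let $E(X)$ be the set of its endpoints, i.e. of the points $x\in X$ for which $X\setminus\{x\}$ has exactly one connected component, and let $E(X)'$ be the set of accumulation points of $E(X)$. Suppose that $E(X)$ is closed in $X$, and let $f:X\to X$ be a continuous map with zero topological entropy. Denote by $P(f)=\{y\in X:\ f^n(y)=y \text{ for some } n\ge 1\}$ the set of periodic points of $f$, and for $x\in X$ denote by $\omega_f(x)=\bigcap_{n\ge 0}\overline{\{f^m(x): m\ge n\}}$ the $\omega$-limit set of $x$. Then for every $x\in X$: 1. if $\omega_f(x)$ is infinite, then $\omega_f(x)\cap P(f)\subset E(X)'$; 2. if $E(X)$ is countable (possibly finite) and $\omega_f(x)$ is uncountable, then $\omega_f(x)\cap P(f)=\emptyset$. -/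

import Mathlib

/-- A dendrite: a locally connected continuum (non-empty compact connected metric space) that
contains no homeomorphic copy of a circle. -/
structure IsDendrite (X : Type*) [MetricSpace X] : Prop where
  compact : CompactSpace X
  connected : ConnectedSpace X
  locallyConnected : LocallyConnectedSpace X
  no_circle : ∀ γ : Circle → X, ¬ Topology.IsEmbedding γ

/-- The order of `x` in `X`: the number of connected components of `X \ {x}`. -/
noncomputable def ord {X : Type*} [TopologicalSpace X] (x : X) : ℕ∞ :=
  ENat.card (ConnectedComponents ({x}ᶜ : Set X))

/-- The set `E(X)` of endpoints of `X`: the points of order one. -/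
def endpoints (X : Type*) [TopologicalSpace X] : Set X :=
  {x | ord x = 1}

/-- The ω-limit set `⋂ n, closure {f^m (x) : m ≥ n}` of the point `x` under `f`. -/
def omegaSet {X : Type*} [TopologicalSpace X] (f : X → X) (x : X) : Set X :=
  omegaLimit Filter.atTop (fun (n : ℕ) (y : X) => f^[n] y) {x}

/-! Let `p` be a periodic point in the ω-limit set. A power `g = f^[m]` fixes `p`, and `p` lies in
`omegaSet g y` for some `y = f^[i] x`; this smaller limit set is still infinite (resp. uncountable),
because finitely many images of it cover the original one. Order `X` away from `o = p`: `y` is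
behind `x` if `y = x` or `x` separates `y` from `o`. Suppose the limit set accumulates at a point
`z` near which every point other than `p` is a cut point. Branches at points close to `z` then reach
a fixed distance from `z`, so finitely many points meet them all, and the pigeonhole principle gives
17 limit points in a chain along an arc without ramification (`exists_chain_of_cut`). The orbit runs
up and down this arc, which creates periodic points on it, and it keeps returning to `p`. A subarc
joining an orbit point to a periodic point is thus stretched over the arc, and two such subarcs form
a horseshoe (`IsFreeArc.hasHorseshoe`), contradicting zero entropy. For the first claim take `z =
p`, which is not isolated in the limit set; for the second, a condensation point of the limit set
outside the closed countable set of endpoints. -/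

/-! ### Horseshoes and positive entropy -/

section Horseshoe

/-- A horseshoe of `f`: two disjoint non-empty compact sets, each of which is mapped by some
positive iterate of `f` onto a set that contains both of them. -/
def HasHorseshoe {X : Type*} [TopologicalSpace X] (f : X → X) : Prop :=
  ∃ (B C : Set X) (n : ℕ), 0 < n ∧ IsCompact B ∧ IsCompact C ∧ B.Nonempty ∧ Disjoint B C ∧
    B ∪ C ⊆ f^[n] '' B ∧ B ∪ C ⊆ f^[n] '' C

theorem HasHorseshoe.of_iterate {X : Type*} [TopologicalSpace X] {f : X → X} {m : ℕ}
    (hm : 0 < m) (h : HasHorseshoe f^[m]) : HasHorseshoe f := by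
  obtain ⟨B, C, n, hn, hB, hC, hne, hd, h₁, h₂⟩ := h
  rw [← Function.iterate_mul] at h₁ h₂
  exact ⟨B, C, m * n, Nat.mul_pos hm hn, hB, hC, hne, hd, h₁, h₂⟩

/-- If `A` contains `B` and some iterate maps `B` onto a superset of `A`, so do its powers. -/
theorem subset_image_iterate_mul {X : Type*} {f : X → X} {A B : Set X} {m : ℕ} (hBA : B ⊆ A)
    (h : A ⊆ f^[m] '' B) {k : ℕ} (hk : 0 < k) : A ⊆ f^[m * k] '' B := by
  induction k, hk using Nat.le_induction with
  | base => simpa using h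
  | succ k hk ih =>
    calc A ⊆ f^[m] '' B := h
      _ ⊆ f^[m] '' A := Set.image_mono hBA
      _ ⊆ f^[m] '' (f^[m * k] '' B) := Set.image_mono ih
      _ = f^[m * (k + 1)] '' B := by
        rw [← Set.image_comp, ← Function.iterate_add, mul_add, mul_one, add_comm]

/-- The two sets of a horseshoe may return at different times. -/
theorem hasHorseshoe_of_covers {X : Type*} [TopologicalSpace X] {f : X → X} {A B C : Set X}
    {m n : ℕ} (hB : IsCompact B) (hC : IsCompact C) (hBn : B.Nonempty) (hCn : C.Nonempty)
    (hd : Disjoint B C) (hBA : B ⊆ A) (hCA : C ⊆ A) (h₁ : A ⊆ f^[m] '' B)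
    (h₂ : A ⊆ f^[n] '' C) : HasHorseshoe f := by
  have hm : 0 < m := by
    rcases Nat.eq_zero_or_pos m with rfl | h
    · obtain ⟨x, hx⟩ := hCn
      exact (Set.disjoint_left.1 hd (by simpa using h₁ (hCA hx)) hx).elim
    · exact h
  have hn : 0 < n := by
    rcases Nat.eq_zero_or_pos n with rfl | h
    · obtain ⟨x, hx⟩ := hBn
      exact (Set.disjoint_left.1 hd hx (by simpa using h₂ (hBA hx))).elim
    · exact h
  have hA := Set.union_subset hBA hCA
  exact ⟨B, C, m * n, Nat.mul_pos hm hn, hB, hC, hBn, hd,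
    hA.trans (subset_image_iterate_mul hBA h₁ hn),
    hA.trans (mul_comm m n ▸ subset_image_iterate_mul hCA h₂ hm)⟩

/-- Every itinerary is realized in a horseshoe. -/
theorem exists_itinerary {X : Type*} {f : X → X} {K : Bool → Set X} {n : ℕ}
    (hne : (K false).Nonempty) (h : ∀ b c, K c ⊆ f^[n] '' K b) (k : ℕ) (w : ℕ → Bool) :
    ∃ x, (∃ b, x ∈ K b) ∧ ∀ i < k, f^[n * i] x ∈ K (w i) := by
  induction k generalizing w with
  | zero => exact ⟨hne.some, ⟨_, hne.some_mem⟩, by simp⟩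
  | succ k ih =>
    obtain ⟨x', ⟨b, hb⟩, hx'⟩ := ih fun i => w (i + 1)
    obtain ⟨x, hx, rfl⟩ := h (w 0) b hb
    refine ⟨x, ⟨_, hx⟩, fun i hi => ?_⟩
    cases i with
    | zero => simpa using hx
    | succ i =>
      rw [mul_add, mul_one, Function.iterate_add_apply]
      exact hx' i (by omega)

-- Disjoint compact sets are uniformly separated, so points realizing the `2 ^ k` itineraries of
-- length `k` have disjoint dynamical balls at time `n * k`. The entropy is therefore at least `log
-- 2 / n`.
open Dynamics Uniformity in
theorem HasHorseshoe.coverEntropy_ne_zero {X : Type*} [UniformSpace X] [T2Space X] {f : X → X}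
    (h : HasHorseshoe f) : coverEntropy f (Set.univ : Set X) ≠ 0 := by
  classical
  obtain ⟨B, C, n, hn, hB, hC, hne, hd, h₁, h₂⟩ := h
  obtain ⟨V, hV, hdV⟩ := hd.exists_uniform_thickening hB hC.isClosed
  have hmono : Monotone fun k => (netMaxcard f Set.univ V k).toENNReal :=
    fun _ _ hk => ENat.toENNReal_mono (netMaxcard_monotone_time f Set.univ V hk)
  have hcard (k : ℕ) : (2 ^ k : ENNReal) ≤ (netMaxcard f Set.univ V (n * k)).toENNReal := by
    let K : Bool → Set X := fun b => if b then C else B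
    have hK : ∀ b c, K c ⊆ f^[n] '' K b := by
      rintro (_ | _) (_ | _) <;> simp only [K, if_true, Bool.false_eq_true, if_false]
      exacts [Set.subset_union_left.trans h₁, Set.subset_union_right.trans h₁,
        Set.subset_union_left.trans h₂, Set.subset_union_right.trans h₂]
    have hdK : ∀ b c, b ≠ c → ∀ x ∈ K b, ∀ y ∈ K c, ∀ u, (x, u) ∈ V → (y, u) ∉ V := by
      rintro (_ | _) (_ | _) hbc x hx y hy u hxu hyu
      · exact hbc rfl
      · exact Set.disjoint_left.1 hdV (Set.mem_biUnion hx hxu) (Set.mem_biUnion hy hyu)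
      · exact Set.disjoint_left.1 hdV (Set.mem_biUnion hy hyu) (Set.mem_biUnion hx hxu)
      · exact hbc rfl
    have hex (w : Fin k → Bool) : ∃ x, ∀ i : Fin k, f^[n * i] x ∈ K (w i) := by
      obtain ⟨x, -, hx⟩ := exists_itinerary (K := K) (by simpa [K] using hne) hK k
        fun i => if hi : i < k then w ⟨i, hi⟩ else false
      exact ⟨x, fun i => by simpa using hx i i.2⟩
    choose x hx using hex
    have hsep : ∀ w w', w ≠ w' → Disjoint (UniformSpace.ball (x w) (dynEntourage f V (n * k)))
        (UniformSpace.ball (x w') (dynEntourage f V (n * k))) := by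
      intro w w' hw
      obtain ⟨i, hi⟩ := Function.ne_iff.1 hw
      rw [Set.disjoint_left]
      intro u hu hu'
      have hlt : n * (i : ℕ) < n * k := Nat.mul_lt_mul_of_pos_left i.2 hn
      exact hdK _ _ hi _ (hx w i) _ (hx w' i) (f^[n * i] u)
        (mem_ball_dynEntourage.1 hu _ hlt) (mem_ball_dynEntourage.1 hu' _ hlt)
    have hinj : Function.Injective x := fun w w' hww => by
      by_contra hw
      have hmem : x w ∈ UniformSpace.ball (x w) (dynEntourage f V (n * k)) :=
        mem_ball_dynEntourage.2 fun _ _ => UniformSpace.mem_ball_self _ hV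
      exact Set.disjoint_left.1 (hsep w w' hw) hmem (hww ▸ hmem)
    have hnet : IsDynNetIn f Set.univ V (n * k) (Finset.univ.image x : Finset X) := by
      refine ⟨Set.subset_univ _, ?_⟩
      rintro _ hw _ hw' hne
      obtain ⟨w, -, rfl⟩ := Finset.mem_image.1 (Finset.mem_coe.1 hw)
      obtain ⟨w', -, rfl⟩ := Finset.mem_image.1 (Finset.mem_coe.1 hw')
      exact hsep w w' fun h => hne (h ▸ rfl)
    have hle := ENat.toENNReal_mono hnet.card_le_netMaxcard
    rw [Finset.card_image_of_injective _ hinj] at hle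
    simpa using hle
  have hgrowth : ENNReal.log 2 ≤ n * netEntropyEntourage f Set.univ V := by
    rw [netEntropyEntourage, ← hmono.expGrowthSup_comp_mul hn.ne', ← ExpGrowth.expGrowthSup_pow]
    exact ExpGrowth.expGrowthSup_monotone hcard
  intro h0
  have hle : netEntropyEntourage f Set.univ V ≤ 0 :=
    h0 ▸ netEntropyEntourage_le_coverEntropy f Set.univ hV
  have hlog : (0 : EReal) < ENNReal.log 2 := ENNReal.zero_lt_log_iff.2 (by norm_num)
  exact absurd (hlog.trans_le hgrowth) (not_lt.2 (mul_nonpos_of_nonneg_of_nonpos (by positivity) hle))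

end Horseshoe

/-! ### Horseshoes from an orbit that travels along a free arc -/

section FreeArc

open Set

/-- A free arc in `X`, with its retraction: `ι` embeds a linearly ordered space `α` in `X`, the map
`r` is a retraction of `X` onto it, and over the open interval `(a, b)` the map `r` is injective. -/
structure IsFreeArc {X α : Type*} [TopologicalSpace X] [TopologicalSpace α] [LinearOrder α]
    (ι : α → X) (r : X → α) (a b : α) : Prop where
  continuous_embed : Continuous ι
  continuous_retract : Continuous r
  left_inv : ∀ t, r (ι t) = t
  right_inv : ∀ x, a < r x → r x < b → ι (r x) = x
  preconnected : ∀ s t : α, IsPreconnected (Icc s t)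

namespace IsFreeArc

variable {X α : Type*} [TopologicalSpace X] [TopologicalSpace α] [LinearOrder α]
  {ι : α → X} {r : X → α} {a b : α} {f : X → X}

/-- An iterate of an arc that reaches both sides of an interval of the free arc covers it. -/
theorem covers [OrderClosedTopology α] (h : IsFreeArc ι r a b) (hf : Continuous f) {n : ℕ}
    {s t u v τ₁ τ₂ : α}
    (hu : u ∈ Icc s t) (hv : v ∈ Icc s t) (h₁ : a < τ₁) (h₂ : τ₂ < b)
    (hu' : r (f^[n] (ι u)) ≤ τ₁) (hv' : τ₂ ≤ r (f^[n] (ι v))) :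
    ι '' Icc τ₁ τ₂ ⊆ f^[n] '' (ι '' Icc s t) := by
  have hc : Continuous fun w => r (f^[n] (ι w)) :=
    h.continuous_retract.comp ((hf.iterate n).comp h.continuous_embed)
  rintro _ ⟨τ, hτ, rfl⟩
  obtain ⟨w, hw, hwτ⟩ := ((h.preconnected s t).image _ hc.continuousOn).Icc_subset
    (mem_image_of_mem _ hu) (mem_image_of_mem _ hv) ⟨hu'.trans hτ.1, hτ.2.trans hv'⟩
  dsimp only at hwτ
  refine ⟨ι w, mem_image_of_mem _ hw, ?_⟩
  rw [← hwτ]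
  exact (h.right_inv _ (hwτ ▸ h₁.trans_le hτ.1) (hwτ ▸ hτ.2.trans_lt h₂)).symm

/-- If `f^[k]` moves some point of an interval of the free arc upwards and another downwards, then
it has a fixed point in this interval. -/
theorem exists_fixed [OrderClosedTopology α] (h : IsFreeArc ι r a b) (hf : Continuous f) {k : ℕ}
    {u v s t : α}
    (hu : a < u) (hv : v < b) (hs : s ∈ Icc u v) (ht : t ∈ Icc u v)
    (hs' : s ≤ r (f^[k] (ι s))) (ht' : r (f^[k] (ι t)) ≤ t) :
    ∃ e ∈ Icc u v, f^[k] (ι e) = ι e := by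
  have hc : Continuous fun w => r (f^[k] (ι w)) :=
    h.continuous_retract.comp ((hf.iterate k).comp h.continuous_embed)
  obtain ⟨e, he, hee⟩ := (h.preconnected u v).intermediate_value₂ hs ht
    continuous_id.continuousOn hc.continuousOn hs' ht'
  simp only [id] at hee
  refine ⟨e, he, ?_⟩
  rw [← h.right_inv (f^[k] (ι e)) (hee ▸ hu.trans_le he.1) (hee ▸ he.2.trans_lt hv), ← hee]

/-- If some points of an interval of the free arc return to it in the increasing direction and
others in the decreasing direction, then the interval contains a periodic point. -/
theorem exists_periodic [OrderClosedTopology α] (h : IsFreeArc ι r a b) (hf : Continuous f)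
    {m n : ℕ} {u v x x' y y' : α}
    (hu : a < u) (hv : v < b) (hx : x ∈ Icc u v) (hx' : x' ∈ Icc u v) (hy : y ∈ Icc u v)
    (hy' : y' ∈ Icc u v) (hxx : x < x') (hyy : y' < y) (hm : f^[m] (ι x) = ι x')
    (hn : f^[n] (ι y) = ι y') : ∃ e ∈ Icc u v, ∃ k, 0 < k ∧ f^[k] (ι e) = ι e := by
  -- Without periodic points, the intermediate value theorem makes each positive iterate, followed
  -- by `r`, move all of `[u, v]` up or all of it down. The multiples of `m` move it up and those of
  -- `n` move it down, which clash at `m * n`.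
  by_contra! hcon
  have up : ∀ k, 0 < k → (∃ s ∈ Icc u v, s < r (f^[k] (ι s))) →
      ∀ t ∈ Icc u v, t < r (f^[k] (ι t)) := by
    rintro k hk ⟨s, hs, hs'⟩ t ht
    by_contra! htk
    obtain ⟨e, he, hee⟩ := h.exists_fixed hf hu hv hs ht hs'.le htk
    exact hcon e he k hk hee
  have down : ∀ k, 0 < k → (∃ s ∈ Icc u v, r (f^[k] (ι s)) < s) →
      ∀ t ∈ Icc u v, r (f^[k] (ι t)) < t := by
    rintro k hk ⟨s, hs, hs'⟩ t ht
    by_contra! htk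
    obtain ⟨e, he, hee⟩ := h.exists_fixed hf hu hv ht hs htk hs'.le
    exact hcon e he k hk hee
  have hm0 : 0 < m := by
    rcases Nat.eq_zero_or_pos m with rfl | hm0
    · have := congrArg r hm
      simp only [Function.iterate_zero, id, h.left_inv] at this
      exact absurd this hxx.ne
    · exact hm0
  have hn0 : 0 < n := by
    rcases Nat.eq_zero_or_pos n with rfl | hn0
    · have := congrArg r hn
      simp only [Function.iterate_zero, id, h.left_inv] at this
      exact absurd this hyy.ne'
    · exact hn0
  have hup : ∀ j, 0 < j → ∀ t ∈ Icc u v, t < r (f^[m * j] (ι t)) := by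
    intro j hj
    induction j, hj using Nat.le_induction with
    | base => exact up _ (by simpa) ⟨x, hx, by simpa [hm, h.left_inv] using hxx⟩
    | succ j hj ih =>
      refine up _ (by positivity) ⟨x, hx, ?_⟩
      rw [mul_add, mul_one, Function.iterate_add_apply, hm]
      exact hxx.trans (ih _ hx')
  have hdown : ∀ j, 0 < j → ∀ t ∈ Icc u v, r (f^[n * j] (ι t)) < t := by
    intro j hj
    induction j, hj using Nat.le_induction with
    | base => exact down _ (by simpa) ⟨y, hy, by simpa [hn, h.left_inv] using hyy⟩
    | succ j hj ih =>
      refine down _ (by positivity) ⟨y, hy, ?_⟩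
      rw [mul_add, mul_one, Function.iterate_add_apply, hn]
      exact (ih _ hy').trans hyy
  exact lt_asymm (hup n hn0 x hx) (mul_comm n m ▸ hdown m hm0 x hx)

end IsFreeArc

theorem frequently_of_mem_omegaSet {X : Type*} [TopologicalSpace X] {f : X → X} {p y : X}
    (h : p ∈ omegaSet f y) {N : Set X} (hN : N ∈ nhds p) (n : ℕ) : ∃ m ≥ n, f^[m] y ∈ N :=
  Filter.frequently_atTop.1 (mapClusterPt_iff_frequently.1
    ((mem_omegaLimit_singleton_iff_mapClusterPt _ _ _ _).1 h) N hN) n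

/-- If an orbit accumulates at a fixed point, so does each of its points under each power. -/
theorem exists_iterate_mul_mem_of_fixed {X : Type*} [TopologicalSpace X] {f : X → X}
    (hf : Continuous f) {p y : X} (hp : f p = p) (hω : p ∈ omegaSet f y) {N : Set X}
    (hN : N ∈ nhds p) (n : ℕ) {k : ℕ} (hk : 0 < k) : ∃ t, f^[k * t] (f^[n] y) ∈ N := by
  -- Since `p` is fixed, an orbit point close enough to `p` stays in `N` for `k` further steps, and
  -- one of these times has the required residue modulo `k`.
  have hN' : (⋂ j ∈ Finset.range (k + 1), f^[j] ⁻¹' N) ∈ nhds p := by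
    refine (Filter.biInter_finset_mem _).2 fun j _ => (hf.iterate j).continuousAt.preimage_mem_nhds ?_
    rwa [Function.iterate_fixed hp]
  obtain ⟨m, hm, hmN⟩ := frequently_of_mem_omegaSet hω hN' n
  obtain ⟨d, rfl⟩ := Nat.exists_eq_add_of_le hm
  have h₁ := Nat.div_add_mod d k
  have h₂ := Nat.mod_lt d hk
  refine ⟨d / k + 1, ?_⟩
  have hj := mem_iInter₂.1 hmN (k - d % k) (Finset.mem_range.2 (by omega))
  rw [mem_preimage, ← Function.iterate_add_apply] at hj
  rw [← Function.iterate_add_apply]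
  have : k * (d / k + 1) + n = k - d % k + (n + d) := by
    rw [mul_add, mul_one]; omega
  rwa [this]

/-- An orbit that accumulates at a fixed point and at sufficiently many points of a free arc
forces a horseshoe. -/
theorem IsFreeArc.hasHorseshoe {X α : Type*} [TopologicalSpace X] [TopologicalSpace α]
    [LinearOrder α] [OrderClosedTopology α] [CompactSpace α] {ι : α → X} {r : X → α} {f : X → X}
    {s : ℕ → α} (h : IsFreeArc ι r (s 0) (s 16)) (hf : Continuous f)
    (hs : ∀ i j, i < j → j ≤ 16 → s i < s j) {p y : X} (hp : f p = p) (hpω : p ∈ omegaSet f y)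
    (hpr : r p ≤ s 0) (hsω : ∀ i, 0 < i → i < 16 → ι (s i) ∈ omegaSet f y) :
    HasHorseshoe f := by
  have hs' : ∀ i j, i ≤ j → j ≤ 16 → s i ≤ s j := fun i j hij hj => by
    rcases hij.eq_or_lt with rfl | hij
    exacts [le_rfl, (hs i j hij hj).le]
  have visit : ∀ i, i < 15 → ∀ n₀, ∃ n ≥ n₀, s i < r (f^[n] y) ∧ r (f^[n] y) < s (i + 2) := by
    intro i hi n₀
    refine frequently_of_mem_omegaSet (hsω (i + 1) (by omega) (by omega))
      (N := r ⁻¹' Ioo (s i) (s (i + 2))) ?_ n₀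
    refine (isOpen_Ioo.preimage h.continuous_retract).mem_nhds ?_
    rw [mem_preimage, h.left_inv]
    exact ⟨hs _ _ (by omega) (by omega), hs _ _ (by omega) (by omega)⟩
  have onArc : ∀ i, i < 15 → ∀ n, s i < r (f^[n] y) ∧ r (f^[n] y) < s (i + 2) →
      ι (r (f^[n] y)) = f^[n] y := fun i hi n hn =>
    h.right_inv _ ((hs' 0 i (by omega) (by omega)).trans_lt hn.1)
      (hn.2.trans_le (hs' _ 16 (by omega) le_rfl))
  have periodic : ∀ i, 0 < i → i + 4 < 16 →
      ∃ e ∈ Icc (s i) (s (i + 4)), ∃ k, 0 < k ∧ f^[k] (ι e) = ι e := by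
    intro i hi hi'
    obtain ⟨n₁, -, h₁⟩ := visit i (by omega) 0
    obtain ⟨n₂, hn₂, h₂⟩ := visit (i + 2) (by omega) n₁
    obtain ⟨n₃, hn₃, h₃⟩ := visit i (by omega) n₂
    have h24 : s (i + 2) < s (i + 4) := hs _ _ (by omega) (by omega)
    have h02 : s i < s (i + 2) := hs _ _ (by omega) (by omega)
    refine h.exists_periodic hf (m := n₂ - n₁) (n := n₃ - n₂) (hs _ _ hi (by omega))
      (hs _ _ hi' le_rfl) ⟨h₁.1.le, (h₁.2.trans h24).le⟩ ⟨(h02.trans h₂.1).le, h₂.2.le⟩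
      ⟨(h02.trans h₂.1).le, h₂.2.le⟩ ⟨h₃.1.le, (h₃.2.trans h24).le⟩ (h₁.2.trans h₂.1)
      (h₃.2.trans h₂.1) ?_ ?_
    · rw [onArc i (by omega) _ h₁, onArc (i + 2) (by omega) _ h₂, ← Function.iterate_add_apply,
        Nat.sub_add_cancel hn₂]
    · rw [onArc (i + 2) (by omega) _ h₂, onArc i (by omega) _ h₃, ← Function.iterate_add_apply,
        Nat.sub_add_cancel hn₃]
  -- At times `j + k * t` the periodic end `e` is always at `f^[j] (ι e)`, while a suitable `t`
  -- brings the other end close to `p`, hence below `τ₁`.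
  have spread : ∀ (e : α) (k : ℕ), 0 < k → f^[k] (ι e) = ι e → ∀ (n j : ℕ) (u v τ₁ τ₂ : α),
      ι (r (f^[n] y)) = f^[n] y → r (f^[n] y) ∈ Icc u v → e ∈ Icc u v → s 0 < τ₁ → τ₂ < s 16 →
      τ₂ ≤ r (f^[j] (ι e)) → ∃ N, ι '' Icc τ₁ τ₂ ⊆ f^[N] '' (ι '' Icc u v) := by
    intro e k hk hke n j u v τ₁ τ₂ hn hnu heu h₁ h₂ hj
    obtain ⟨t, ht⟩ := exists_iterate_mul_mem_of_fixed hf hp hpω (N := r ⁻¹' Iio τ₁)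
      ((isOpen_Iio.preimage h.continuous_retract).mem_nhds (hpr.trans_lt h₁)) (j + n) hk
    refine ⟨j + k * t, h.covers hf hnu heu h₁ h₂ ?_ ?_⟩
    · rw [hn, ← Function.iterate_add_apply, show j + k * t + n = k * t + (j + n) by omega,
        Function.iterate_add_apply]
      exact (mem_Iio.1 ht).le
    · rw [Function.iterate_add_apply, Function.iterate_mul, Function.iterate_fixed hke]
      exact hj
  -- The indices are spaced to give `c₀ < e₁ < c₁ < c₁' < e₂ < c₂` on the arc, with `e₁`, `e₂`
  -- periodic, the `c`'s on the orbit of `y`, and `c₂` visited no earlier than `c₁`.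
  obtain ⟨e₁, he₁, k₁, hk₁, hke₁⟩ := periodic 2 (by omega) (by omega)
  obtain ⟨e₂, he₂, k₂, hk₂, hke₂⟩ := periodic 10 (by omega) (by omega)
  obtain ⟨n₀, -, h₀⟩ := visit 0 (by omega) 0
  obtain ⟨n₁, -, h₁⟩ := visit 6 (by omega) 0
  obtain ⟨n₁', -, h₁'⟩ := visit 8 (by omega) 0
  obtain ⟨n₂, hn₂, h₂⟩ := visit 14 (by omega) n₁
  have o₀ := onArc 0 (by omega) _ h₀
  have o₁ := onArc 6 (by omega) _ h₁
  have o₁' := onArc 8 (by omega) _ h₁'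
  have o₂ := onArc 14 (by omega) _ h₂
  norm_num at he₁ he₂ h₀ h₁ h₁' h₂
  have hcpt : ∀ u v : α, IsCompact (ι '' Icc u v) := fun u v =>
    isClosed_Icc.isCompact.image h.continuous_embed
  have hinj : Function.Injective ι := Function.LeftInverse.injective h.left_inv
  have hdisj : ∀ u v u' v' : α, v < u' → Disjoint (ι '' Icc u v) (ι '' Icc u' v') := by
    intro u v u' v' hv
    refine (disjoint_image_iff hinj).2 (disjoint_left.2 fun t ht ht' => ?_)
    exact absurd (ht.2.trans_lt hv) (not_lt.2 ht'.1)
  have hne : ∀ u v : α, u ≤ v → (ι '' Icc u v).Nonempty := fun u v huv =>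
    (nonempty_Icc.2 huv).image ι
  have h02 := hs 0 2 (by omega) (by omega)
  have h1416 := hs 14 16 (by omega) (by omega)
  generalize hc₀ : r (f^[n₀] y) = c₀ at *
  generalize hc₁ : r (f^[n₁] y) = c₁ at *
  generalize hc₁' : r (f^[n₁'] y) = c₁' at *
  generalize hc₂ : r (f^[n₂] y) = c₂ at *
  have hc₀e₁ : c₀ < e₁ := h₀.2.trans_le he₁.1
  have he₁c₁ : e₁ < c₁ := he₁.2.trans_lt h₁.1
  have hc₁c₁' : c₁ < c₁' := h₁.2.trans h₁'.1
  have hc₁'e₂ : c₁' < e₂ := h₁'.2.trans_le he₂.1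
  have he₂c₂ : e₂ < c₂ := he₂.2.trans_lt h₂.1
  have hj : f^[n₂ - n₁] (ι c₁) = ι c₂ := by
    rw [o₁, o₂, ← Function.iterate_add_apply, Nat.sub_add_cancel hn₂]
  have he₂b : e₂ < s 16 := he₂.2.trans_lt h1416
  have hc₁e₂ := hc₁c₁'.trans hc₁'e₂
  have hae₁ : s 0 < e₁ := h₀.1.trans hc₀e₁
  -- If `e₁` is carried to `e₂` or above, `[c₀, e₁]` and `[c₁, e₂]` both cover `[c₀, e₂]`. Otherwise
  -- `[e₁, c₁]` covers `[e₂, c₂]`, which covers `[e₁, e₂]`, and `[c₁', e₂]` covers `[e₁, e₂]` as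
  -- well.
  rcases le_or_gt e₂ (r (f^[n₂ - n₁] (ι e₁))) with hcase | hcase
  · obtain ⟨N, hN⟩ := spread e₁ k₁ hk₁ hke₁ n₀ (n₂ - n₁) c₀ e₁ c₀ e₂ (hc₀ ▸ o₀)
      ⟨hc₀.ge, hc₀.trans_le hc₀e₁.le⟩ ⟨hc₀e₁.le, le_rfl⟩ h₀.1 he₂b hcase
    obtain ⟨M, hM⟩ := spread e₂ k₂ hk₂ hke₂ n₁ 0 c₁ e₂ c₀ e₂ (hc₁ ▸ o₁)
      ⟨hc₁.ge, hc₁.trans_le hc₁e₂.le⟩ ⟨hc₁e₂.le, le_rfl⟩ h₀.1 he₂b (h.left_inv e₂).ge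
    exact hasHorseshoe_of_covers (hcpt _ _) (hcpt _ _) (hne _ _ hc₀e₁.le) (hne _ _ hc₁e₂.le)
      (hdisj _ _ _ _ he₁c₁) (image_mono (Icc_subset_Icc le_rfl (he₁c₁.trans hc₁e₂).le))
      (image_mono (Icc_subset_Icc (hc₀e₁.trans he₁c₁).le le_rfl)) hN hM
  · have hfirst : ι '' Icc e₂ c₂ ⊆ f^[n₂ - n₁] '' (ι '' Icc e₁ c₁) := by
      refine h.covers hf ⟨le_rfl, he₁c₁.le⟩ ⟨he₁c₁.le, le_rfl⟩ (hae₁.trans (he₁c₁.trans hc₁e₂))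
        h₂.2 hcase.le ?_
      rw [hj, h.left_inv]
    obtain ⟨N, hN⟩ := spread e₂ k₂ hk₂ hke₂ n₂ 0 e₂ c₂ e₁ e₂ (hc₂ ▸ o₂)
      ⟨he₂c₂.le.trans_eq hc₂.symm, hc₂.le⟩ ⟨le_rfl, he₂c₂.le⟩ hae₁ he₂b (h.left_inv e₂).ge
    obtain ⟨M, hM⟩ := spread e₂ k₂ hk₂ hke₂ n₁' 0 c₁' e₂ e₁ e₂ (hc₁' ▸ o₁')
      ⟨hc₁'.ge, hc₁'.trans_le hc₁'e₂.le⟩ ⟨hc₁'e₂.le, le_rfl⟩ hae₁ he₂b (h.left_inv e₂).ge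
    have hN' : ι '' Icc e₁ e₂ ⊆ f^[N + (n₂ - n₁)] '' (ι '' Icc e₁ c₁) := by
      rw [Function.iterate_add, image_comp]
      exact hN.trans (image_mono hfirst)
    exact hasHorseshoe_of_covers (hcpt _ _) (hcpt _ _) (hne _ _ he₁c₁.le) (hne _ _ hc₁'e₂.le)
      (hdisj _ _ _ _ hc₁c₁') (image_mono (Icc_subset_Icc le_rfl hc₁e₂.le))
      (image_mono (Icc_subset_Icc (he₁c₁.trans hc₁c₁').le le_rfl)) hN' hM

end FreeArc

/-! ### The separation order seen from a base point -/

section Branch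

open Set Topology

/-- The part of `X` behind `x` as seen from `o`: the complement of the component of `o` in
`X \ {x}`. -/
def branch {X : Type*} [TopologicalSpace X] (o x : X) : Set X :=
  (connectedComponentIn {x}ᶜ o)ᶜ

variable {X : Type*} [TopologicalSpace X] {o x y : X}

theorem self_mem_branch : x ∈ branch o x := fun h =>
  connectedComponentIn_subset _ _ h rfl

theorem base_notMem_branch (hx : x ≠ o) : o ∉ branch o x := fun h =>
  h (mem_connectedComponentIn hx.symm)

theorem ne_of_mem_branch (hx : x ≠ o) (hy : y ∈ branch o x) : y ≠ o := fun h =>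
  base_notMem_branch hx (h ▸ hy)

theorem isClosed_branch [T1Space X] [LocallyConnectedSpace X] : IsClosed (branch o x) :=
  (isOpen_compl_singleton.connectedComponentIn).isClosed_compl

theorem isOpen_branch_diff [T1Space X] [LocallyConnectedSpace X] :
    IsOpen (branch o x \ {x}) := by
  refine isOpen_iff_forall_mem_open.2 fun y hy => ⟨connectedComponentIn {x}ᶜ y, ?_,
    isOpen_compl_singleton.connectedComponentIn, mem_connectedComponentIn hy.2⟩
  refine fun w hw => ⟨fun hw' => hy.1 ?_, connectedComponentIn_subset _ _ hw⟩
  rw [connectedComponentIn_eq hw', ← connectedComponentIn_eq hw]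
  exact mem_connectedComponentIn hy.2

/-- A connected set that avoids `x` and meets the branch at `x` lies in this branch. -/
theorem IsPreconnected.subset_branch [T1Space X] [LocallyConnectedSpace X] {s : Set X}
    (hs : IsPreconnected s) (hx : x ∉ s) (h : (s ∩ branch o x).Nonempty) :
    s ⊆ branch o x \ {x} := by
  obtain ⟨w, hw, hwb⟩ := h
  refine hs.subset_left_of_subset_union isOpen_branch_diff
    (isOpen_compl_singleton.connectedComponentIn (x := o) (F := {x}ᶜ)) ?_ ?_ ⟨w, hw, hwb, ?_⟩
  · exact disjoint_left.2 fun v hv hv' => hv.1 hv'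
  · intro v hv
    by_cases hvb : v ∈ branch o x
    · exact Or.inl ⟨hvb, fun h => hx (h ▸ hv)⟩
    · exact Or.inr (not_not.1 hvb)
  · exact fun h => hx (h ▸ hw)

/-- One side of any separation misses `x`, so only such sides need to be excluded. For a branch they
are clopen in all of `X`. -/
theorem isPreconnected_of_forall_clopen {s : Set X} (hs : IsClosed s) (hx : x ∈ s)
    (h : ∀ F ⊆ s, IsClosed F → IsClosed (s \ F) → x ∉ F → F = ∅) : IsPreconnected s := by
  have key : ∀ F G : Set X, IsClosed F → IsClosed G → s ⊆ F ∪ G → (s ∩ F).Nonempty → x ∈ G →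
      (s ∩ (F ∩ G)).Nonempty := by
    intro F G hF hG hFG hsF hxG
    by_contra hcon
    have hdisj : ∀ w ∈ s, w ∈ F → w ∉ G := fun w hw hwF hwG => hcon ⟨w, hw, hwF, hwG⟩
    refine hsF.ne_empty (h _ inter_subset_left (hs.inter hF) ?_ fun hxF => hdisj x hx hxF.2 hxG)
    convert hs.inter hG using 1
    ext w
    constructor
    · rintro ⟨hw, hwF⟩
      exact ⟨hw, (hFG hw).resolve_left fun h => hwF ⟨hw, h⟩⟩
    · rintro ⟨hw, hwG⟩
      exact ⟨hw, fun h => hdisj w hw h.2 hwG⟩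
  rw [isPreconnected_closed_iff]
  intro F G hF hG hFG hsF hsG
  rcases hFG hx with hxF | hxG
  · rw [inter_comm F G]
    exact key G F hG hF (union_comm F G ▸ hFG) hsG hxF
  · exact key F G hF hG hFG hsF hxG

theorem isPreconnected_branch [T1Space X] [LocallyConnectedSpace X] [PreconnectedSpace X] :
    IsPreconnected (branch o x) := by
  refine isPreconnected_of_forall_clopen isClosed_branch self_mem_branch
    fun F hFs hF hF' hx => ?_
  have hopen : IsOpen F := by
    convert (isOpen_branch_diff (o := o) (x := x)).inter hF'.isOpen_compl using 1
    ext w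
    constructor
    · exact fun hw => ⟨⟨hFs hw, fun h => hx (h ▸ hw)⟩, fun h => h.2 hw⟩
    · exact fun hw => by_contra fun h => hw.2 ⟨hw.1.1, h⟩
  rcases isClopen_iff.1 ⟨hF, hopen⟩ with h | h
  · exact h
  · exact absurd (h ▸ mem_univ x) hx

variable [T1Space X] [LocallyConnectedSpace X] [PreconnectedSpace X]

/-- This is antisymmetry. If each point were behind the other, `branch o x` would be the union of
the two open sets `branch o x \ {x}` and `branch o y \ {y}`, hence clopen, although it contains `x`
and not `o`. -/
theorem notMem_branch_of_mem (hx : x ≠ o) (hy : y ∈ branch o x) (hyx : y ≠ x) :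
    x ∉ branch o y := by
  intro hxy
  have hyo := ne_of_mem_branch hx hy
  have hsub : branch o y ⊆ branch o x := by
    refine compl_subset_compl.2 (isPreconnected_connectedComponentIn.subset_connectedComponentIn
      (mem_connectedComponentIn hx.symm) fun w hw h => hy ?_)
    rwa [mem_singleton_iff.1 h] at hw
  have hopen : IsOpen (branch o x) := by
    convert (isOpen_branch_diff (o := o) (x := x)).union (isOpen_branch_diff (o := o) (x := y))
      using 1
    ext w
    constructor
    · intro hw
      by_cases hwx : w = x
      · exact Or.inr (hwx ▸ ⟨hxy, hyx.symm⟩)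
      · exact Or.inl ⟨hw, hwx⟩
    · rintro (hw | hw)
      exacts [hw.1, hsub hw.1]
  rcases isClopen_iff.1 ⟨isClosed_branch, hopen⟩ with h | h
  · exact absurd (h ▸ self_mem_branch) (notMem_empty x)
  · exact base_notMem_branch hx (h ▸ mem_univ o)

theorem branch_subset_diff (hx : x ≠ o) (hy : y ∈ branch o x) (hyx : y ≠ x) :
    branch o y ⊆ branch o x \ {x} :=
  isPreconnected_branch.subset_branch (notMem_branch_of_mem hx hy hyx) ⟨y, self_mem_branch, hy⟩

theorem branch_subset_of_mem (hx : x ≠ o) (hy : y ∈ branch o x) : branch o y ⊆ branch o x := by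
  rcases eq_or_ne y x with rfl | hyx
  exacts [subset_rfl, (branch_subset_diff hx hy hyx).trans sdiff_subset]

theorem mem_branch_or_mem_branch {w : X} (hx : w ∈ branch o x) (hy : w ∈ branch o y) :
    x ∈ branch o y ∨ y ∈ branch o x := by
  by_contra! h
  exact h.2 ((isPreconnected_branch (o := o) (x := y)).subset_branch (o := o) h.1
    ⟨w, hy, hx⟩ self_mem_branch).1

/-- The arc from `x` to a point `y` behind it is connected. -/
theorem isPreconnected_branch_diff (hy : y ∈ branch o x) :
    IsPreconnected (branch o x \ (branch o y \ {y})) := by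
  refine isPreconnected_of_forall_clopen (x := y) (isClosed_branch.sdiff isOpen_branch_diff)
    ⟨hy, fun h => h.2 rfl⟩ fun F hFs hF hF' hyF => ?_
  by_contra hne
  obtain ⟨w, hw⟩ := nonempty_iff_ne_empty.2 hne
  obtain ⟨v, -, hvF, hv⟩ := isPreconnected_closed_iff.1 (isPreconnected_branch (o := o) (x := x)) F
    ((branch o x \ (branch o y \ {y})) \ F ∪ branch o y) hF (hF'.union isClosed_branch)
    (fun v hv => by
      by_cases hvF : v ∈ F
      · exact Or.inl hvF
      · by_cases hvy : v ∈ branch o y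
        · exact Or.inr (Or.inr hvy)
        · exact Or.inr (Or.inl ⟨⟨hv, fun h => hvy h.1⟩, hvF⟩))
    ⟨w, (hFs hw).1, hw⟩ ⟨y, hy, Or.inr self_mem_branch⟩
  rcases hv with hv | hv
  · exact hv.2 hvF
  · exact (hFs hvF).2 ⟨hv, fun h => hyF (h ▸ hvF)⟩

/-- A branch leaves every set that consists of cut points. -/
theorem not_branch_subset_of_cut [CompactSpace X] {U : Set X}
    (hU : ∀ w ∈ U, w ≠ o → ¬ IsPreconnected ({w}ᶜ : Set X)) (hx : x ≠ o) : ¬ branch o x ⊆ U := by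
  intro hxU
  -- By compactness a chain of branches has a common point, whose own branch is a lower bound; so a
  -- minimal branch exists. It reduces to its vertex, which then cannot be a cut point.
  obtain ⟨m, -, ⟨y, hy, rfl⟩, hmin⟩ := zorn_superset_nonempty (branch o '' branch o x) (by
    intro c hc hchain hne
    have : Nonempty c := hne.to_subtype
    obtain ⟨w, hw⟩ := IsCompact.nonempty_sInter_of_directed_nonempty_isCompact_isClosed
      (S := c) (fun s hs t ht => (hchain.total hs ht).elim
        (fun h => ⟨s, hs, subset_rfl, h⟩) fun h => ⟨t, ht, h, subset_rfl⟩)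
      (fun s hs => by obtain ⟨y, -, rfl⟩ := hc hs; exact ⟨y, self_mem_branch⟩)
      (fun s hs => by obtain ⟨y, -, rfl⟩ := hc hs; exact isClosed_branch.isCompact)
      (fun s hs => by obtain ⟨y, -, rfl⟩ := hc hs; exact isClosed_branch)
    obtain ⟨s, hs⟩ := hne
    refine ⟨branch o w, ⟨w, ?_, rfl⟩, fun t ht => ?_⟩
    · obtain ⟨y, hy, rfl⟩ := hc hs
      exact branch_subset_of_mem hx hy (hw _ hs)
    · obtain ⟨y, hy, rfl⟩ := hc ht
      exact branch_subset_of_mem (ne_of_mem_branch hx hy) (hw _ ht))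
    (branch o x) ⟨x, self_mem_branch, rfl⟩
  have hyo := ne_of_mem_branch hx hy
  have hex : ∃ w ∈ branch o y, w ≠ y := by
    by_contra! hcon
    refine hU y (hxU hy) hyo ?_
    convert isPreconnected_connectedComponentIn (F := {y}ᶜ) (x := o) using 1
    refine (connectedComponentIn_subset _ _).antisymm' fun w hw => ?_
    by_contra hwb
    exact hw (hcon w hwb)
  obtain ⟨w, hw, hwy⟩ := hex
  have h := hmin ⟨w, branch_subset_of_mem hx hy hw, rfl⟩ (branch_subset_of_mem hyo hw)
  exact notMem_branch_of_mem hyo hw hwy (h self_mem_branch)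

end Branch

/-! ### Unramified pieces as linearly ordered arcs -/

section BranchArc

open Set Topology

variable {X : Type*} [TopologicalSpace X] {o a b : X}

/-- The points between `a` and `b`, ends included. -/
def branchArc (o a b : X) : Set X := branch o a \ (branch o b \ {b})

theorem ne_base_of_mem_branchArc (ha : a ≠ o) {x : X} (hx : x ∈ branchArc o a b) : x ≠ o :=
  ne_of_mem_branch ha hx.1

theorem end_mem_branch (h : ∀ x ∈ branch o a \ branch o b, b ∈ branch o x) {x : X}
    (hx : x ∈ branchArc o a b) : b ∈ branch o x := by
  by_cases hxb : x ∈ branch o b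
  · have : x = b := by_contra fun hne => hx.2 ⟨hxb, hne⟩
    exact this ▸ self_mem_branch
  · exact h x ⟨hx.1, hxb⟩

open Classical in
/-- The retraction of `X` onto the arc between `a` and `b`. -/
noncomputable def branchRetract (o a b x : X) : X :=
  if x ∈ branch o b then b else if x ∈ branch o a then x else a

theorem branchRetract_of_mem {x : X} (hx : x ∈ branchArc o a b) : branchRetract o a b x = x := by
  unfold branchRetract
  split_ifs with h₁ h₂
  · exact by_contra fun hne => hx.2 ⟨h₁, fun h => hne h.symm⟩
  · rfl
  · exact absurd hx.1 h₂

variable [T1Space X] [LocallyConnectedSpace X] [PreconnectedSpace X]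

open Classical in
/-- The order of an arc: `x ≤ y` if `y` is in the branch at `x`. -/
noncomputable abbrev branchArcOrder (ha : a ≠ o)
    (h : ∀ x ∈ branch o a \ branch o b, b ∈ branch o x) : LinearOrder (branchArc o a b) where
  le x y := (y : X) ∈ branch o (x : X)
  le_refl _ := self_mem_branch
  le_trans x _ _ hxy hyz := branch_subset_of_mem (ne_base_of_mem_branchArc ha x.2) hxy hyz
  le_antisymm x _ hxy hyx := by
    by_contra hne
    exact notMem_branch_of_mem (ne_base_of_mem_branchArc ha x.2) hxy
      (fun h => hne (Subtype.ext h.symm)) hyx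
  le_total x y := (mem_branch_or_mem_branch (end_mem_branch h x.2) (end_mem_branch h y.2)).symm
  toDecidableLE := inferInstance

/-- This identifies order intervals of the arc with differences of branches, whose connectedness is
already known. -/
theorem mem_branchArc_of_between (ha : a ≠ o) (h : ∀ x ∈ branch o a \ branch o b, b ∈ branch o x)
    {u v w : X} (hu : u ∈ branchArc o a b) (hv : v ∈ branchArc o a b) (huw : w ∈ branch o u)
    (hwv : w ∉ branch o v \ {v}) : w ∈ branchArc o a b ∧ v ∈ branch o w := by
  by_cases hwv' : w ∈ branch o v
  · have : w = v := by_contra fun hne => hwv ⟨hwv', hne⟩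
    rw [this]
    exact ⟨hv, self_mem_branch⟩
  · have hwa : w ∈ branch o a := branch_subset_of_mem ha hu.1 huw
    have hwb : w ∉ branch o b := fun hwb => hwv' (branch_subset_of_mem
      (ne_base_of_mem_branchArc ha hv) (end_mem_branch h hv) hwb)
    have hw : w ∈ branchArc o a b := ⟨hwa, fun h => hwb h.1⟩
    exact ⟨hw, (mem_branch_or_mem_branch (end_mem_branch h hw)
      (end_mem_branch h hv)).resolve_left hwv'⟩

theorem isPreconnected_branchArc_Icc (ha : a ≠ o)
    (h : ∀ x ∈ branch o a \ branch o b, b ∈ branch o x) :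
    letI := branchArcOrder ha h
    ∀ u v : branchArc o a b, IsPreconnected (Icc u v) := by
  let _ := branchArcOrder ha h
  intro u v
  rcases lt_or_ge v u with huv | huv
  · rw [Icc_eq_empty_of_lt huv]
    exact isPreconnected_empty
  rw [← IsInducing.subtypeVal.isPreconnected_image]
  convert isPreconnected_branch_diff (o := o) (x := (u : X)) (y := v) huv using 1
  ext w
  constructor
  · rintro ⟨w, ⟨huw, hwv⟩, rfl⟩
    exact ⟨huw, fun hw => notMem_branch_of_mem (ne_base_of_mem_branchArc ha v.2) hw.1 hw.2 hwv⟩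
  · rintro ⟨huw, hwv⟩
    obtain ⟨hw, hvw⟩ := mem_branchArc_of_between ha h u.2 v.2 huw hwv
    exact ⟨⟨w, hw⟩, ⟨huw, hvw⟩, rfl⟩

/-- For `u < v`, the connected interval `[u, v]` has a third point `w`, and the open rays below and
above `w` separate `u` from `v`. -/
theorem orderClosedTopology_branchArc (ha : a ≠ o)
    (h : ∀ x ∈ branch o a \ branch o b, b ∈ branch o x) :
    letI := branchArcOrder ha h
    OrderClosedTopology (branchArc o a b) := by
  let _ := branchArcOrder ha h
  refine ⟨isOpen_compl_iff.1 (isOpen_iff_forall_mem_open.2 ?_)⟩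
  rintro ⟨v, u⟩ huv
  have huv : u < v := not_le.1 huv
  obtain ⟨w, ⟨huw, hwv⟩, hne⟩ : ∃ w ∈ Icc u v, w ∉ ({u, v} : Set (branchArc o a b)) :=
    ((isPreconnected_branchArc_Icc ha h u v).infinite_of_nontrivial
      ⟨u, ⟨le_rfl, huv.le⟩, v, ⟨huv.le, le_rfl⟩, huv.ne⟩).exists_notMem_finite (toFinite _)
  simp only [mem_insert_iff, mem_singleton_iff, not_or] at hne
  have hup : IsOpen {x : branchArc o a b | w < x} := by
    convert (isOpen_branch_diff (o := o) (x := (w : X))).preimage continuous_subtype_val using 1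
    ext x
    rw [mem_ofPred_eq, lt_iff_le_and_ne, mem_preimage, mem_sdiff, mem_singleton_iff,
      ← Subtype.ext_iff, ne_comm]
    rfl
  have hdown : IsOpen {x : branchArc o a b | x < w} := by
    convert (isClosed_branch (o := o) (x := (w : X))).isOpen_compl.preimage
      (continuous_subtype_val (p := (· ∈ branchArc o a b))) using 1
    ext x
    rw [mem_ofPred_eq, ← not_le]
    rfl
  refine ⟨{x | w < x} ×ˢ {x | x < w}, fun q hq h => ?_, hup.prod hdown,
    ⟨lt_of_le_of_ne hwv hne.2, lt_of_le_of_ne huw (Ne.symm hne.1)⟩⟩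
  have h₁ : w < q.1 := hq.1
  have h₂ : q.2 < w := hq.2
  have h₃ : q.1 ≤ q.2 := h
  exact absurd (h₂.trans h₁) (not_lt.2 h₃)

theorem branchRetract_mem (hb : b ∈ branch o a) (hab : b ≠ a) (ha : a ≠ o) (x : X) :
    branchRetract o a b x ∈ branchArc o a b := by
  unfold branchRetract
  split_ifs with h₁ h₂
  · exact ⟨hb, fun h => h.2 rfl⟩
  · exact ⟨h₂, fun h => h₁ h.1⟩
  · exact ⟨self_mem_branch, fun h => notMem_branch_of_mem ha hb hab h.1⟩

theorem continuous_branchRetract (hb : b ∈ branch o a) (hab : b ≠ a) (ha : a ≠ o) :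
    Continuous (branchRetract o a b) := by
  have h₁ : ContinuousOn (branchRetract o a b) (branch o b) :=
    continuousOn_const.congr fun x hx => if_pos hx
  have h₂ : ContinuousOn (branchRetract o a b) (branchArc o a b) :=
    continuousOn_id.congr fun x hx => branchRetract_of_mem hx
  have h₃ : ContinuousOn (branchRetract o a b) (branch o a \ {a})ᶜ := by
    refine (continuousOn_const (c := a)).congr fun x hx => ?_
    unfold branchRetract
    split_ifs with hxb hxa
    · exact absurd (branch_subset_diff ha hb hab hxb) hx
    · exact by_contra fun hne => hx ⟨hxa, hne⟩
    · rfl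
  have h₁₂ := h₁.union_of_isClosed h₂ isClosed_branch (isClosed_branch.sdiff isOpen_branch_diff)
  have h₁₂₃ := h₁₂.union_of_isClosed h₃
    (isClosed_branch.union (isClosed_branch.sdiff isOpen_branch_diff))
    isOpen_branch_diff.isClosed_compl
  rw [← continuousOn_univ]
  refine h₁₂₃.mono fun x _ => ?_
  by_cases hxb : x ∈ branch o b
  · exact Or.inl (Or.inl hxb)
  · by_cases hxa : x ∈ branch o a
    · exact Or.inl (Or.inr ⟨hxa, fun h => hxb h.1⟩)
    · exact Or.inr fun h => hxa h.1

theorem hasHorseshoe_of_chain [CompactSpace X] {f : X → X} (hf : Continuous f) {y : X} {s : ℕ → X}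
    (hs₀ : s 0 ≠ o) (hs : ∀ i j, i < j → j ≤ 16 → s j ∈ branch o (s i) \ {s i})
    (hbetween : ∀ x ∈ branch o (s 0) \ branch o (s 16), s 16 ∈ branch o x) (ho : f o = o)
    (hoω : o ∈ omegaSet f y) (hsω : ∀ i, s i ∈ omegaSet f y) : HasHorseshoe f := by
  let _ := branchArcOrder hs₀ hbetween
  have := orderClosedTopology_branchArc hs₀ hbetween
  obtain ⟨hb, hab⟩ := hs 0 16 (by omega) le_rfl
  have : CompactSpace (branchArc o (s 0) (s 16)) := isCompact_iff_compactSpace.1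
    (isClosed_branch.sdiff isOpen_branch_diff).isCompact
  have hmem : ∀ i ≤ 16, s i ∈ branchArc o (s 0) (s 16) := by
    intro i hi
    constructor
    · rcases Nat.eq_zero_or_pos i with rfl | hi0
      exacts [self_mem_branch, (hs 0 i hi0 hi).1]
    · rintro ⟨h₁, h₂⟩
      have hi' : i < 16 := lt_of_le_of_ne hi fun h => h₂ (h ▸ rfl)
      have hio : s i ≠ o := by
        rcases Nat.eq_zero_or_pos i with rfl | hi0
        exacts [hs₀, ne_of_mem_branch hs₀ (hs 0 i hi0 hi).1]
      exact notMem_branch_of_mem hio (hs i 16 hi' le_rfl).1 (hs i 16 hi' le_rfl).2 h₁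
  -- The default value beyond index 16 plays no role.
  let t : ℕ → branchArc o (s 0) (s 16) := fun i =>
    if hi : i ≤ 16 then ⟨s i, hmem i hi⟩ else ⟨s 0, hmem 0 (by omega)⟩
  have ht : ∀ i ≤ 16, (t i : X) = s i := fun i hi => by simp [t, hi]
  let r : X → branchArc o (s 0) (s 16) := fun x => ⟨_, branchRetract_mem hb hab hs₀ x⟩
  have harc : IsFreeArc (Subtype.val : branchArc o (s 0) (s 16) → X) r (t 0) (t 16) := by
    refine ⟨continuous_subtype_val, (continuous_branchRetract hb hab hs₀).subtype_mk _,
      fun x => Subtype.ext (branchRetract_of_mem x.2), fun x h₁ h₂ => ?_,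
      isPreconnected_branchArc_Icc hs₀ hbetween⟩
    have h₁' : branchRetract o (s 0) (s 16) x ≠ s 0 := fun h =>
      h₁.ne (Subtype.ext (h.trans (ht 0 (by omega)).symm).symm)
    have h₂' : branchRetract o (s 0) (s 16) x ≠ s 16 := fun h =>
      h₂.ne (Subtype.ext (h.trans (ht 16 le_rfl).symm))
    change branchRetract o (s 0) (s 16) x = x
    unfold branchRetract at h₁' h₂' ⊢
    split_ifs at h₁' h₂' ⊢ <;> simp_all
  refine harc.hasHorseshoe hf (fun i j hij hj => ?_) ho hoω ?_ fun i _ hi => ?_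
  · have h := hs i j hij hj
    rw [← ht i (by omega), ← ht j hj] at h
    exact lt_of_le_of_ne h.1 fun he => h.2 (he ▸ rfl)
  · have : r o = t 0 := Subtype.ext (by
      rw [ht 0 (by omega)]
      change branchRetract o (s 0) (s 16) o = s 0
      unfold branchRetract
      rw [if_neg (base_notMem_branch (ne_of_mem_branch hs₀ hb)),
        if_neg (base_notMem_branch hs₀)])
    exact this.le
  · rw [ht i hi.le]
    exact hsω i

end BranchArc

/-! ### Long chains near a point surrounded by cut points -/

section CutPoints

open Set Topology

/-- Near a point all of whose neighbours are cut points, finitely many points meet all branches. -/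
theorem exists_finset_meeting_branches {X : Type*} [MetricSpace X] [CompactSpace X]
    [PreconnectedSpace X] [LocallyConnectedSpace X] {o z : X} {ρ : ℝ} (hρ : 0 < ρ)
    (hU : ∀ w ∈ Metric.closedBall z ρ, w ≠ o → ¬ IsPreconnected ({w}ᶜ : Set X)) :
    ∃ Y : Finset X, ∀ x ∈ Metric.ball z (ρ / 2), x ≠ o → ∃ y ∈ Y, y ∈ branch o x := by
  have hN : ∀ y ∈ Metric.sphere z ρ, ∃ N ∈ 𝓝 y, IsPreconnected N ∧
      N ⊆ (Metric.closedBall z (ρ / 2))ᶜ := by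
    intro y hy
    have hmem : (Metric.closedBall z (ρ / 2))ᶜ ∈ 𝓝 y :=
      Metric.isClosed_closedBall.isOpen_compl.mem_nhds (by
        rw [mem_compl_iff, Metric.mem_closedBall, Metric.mem_sphere.1 hy]
        linarith)
    obtain ⟨N, hN, hNs⟩ := (LocallyConnectedSpace.open_connected_basis y).mem_iff.1 hmem
    exact ⟨N, hN.1.mem_nhds hN.2.1, hN.2.2.isPreconnected, hNs⟩
  choose! N hN₁ hN₂ hN₃ using hN
  obtain ⟨Y, hYs, hY⟩ := (Metric.isClosed_sphere (x := z) (ε := ρ)).isCompact.elim_nhds_subcover N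
    hN₁
  refine ⟨Y, fun x hx hxo => ?_⟩
  rw [Metric.mem_ball] at hx
  -- The branch leaves the closed ball, so it crosses the sphere inside some `N y`. As `N y` is
  -- connected and avoids `x`, it lies in the branch.
  obtain ⟨w, hw, hwU⟩ := not_subset.1 (not_branch_subset_of_cut hU hxo)
  rw [Metric.mem_closedBall, not_le] at hwU
  obtain ⟨v, hv, hvρ⟩ := (isPreconnected_branch (o := o) (x := x)).intermediate_value
    self_mem_branch hw (f := fun u => dist u z) (by fun_prop) ⟨by linarith, hwU.le⟩
  obtain ⟨y, hy, hvy⟩ := mem_iUnion₂.1 (hY hvρ)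
  have hxN : x ∉ N y := fun h => hN₃ y (hYs y hy) h (Metric.mem_closedBall.2 hx.le)
  exact ⟨y, hy, ((hN₂ y (hYs y hy)).subset_branch hxN ⟨v, hvy, hv⟩
    (mem_of_mem_nhds (hN₁ y (hYs y hy)))).1⟩

/-- Near a point all of whose neighbours are cut points, each infinite set contains a long chain
in a free arc. -/
theorem exists_chain_of_cut {X : Type*} [MetricSpace X] [CompactSpace X]
    [PreconnectedSpace X] [LocallyConnectedSpace X] {o z : X} {U S : Set X} (hzU : U ∈ 𝓝 z)
    (hU : ∀ w ∈ U, w ≠ o → ¬ IsPreconnected ({w}ᶜ : Set X))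
    (hS : ∀ N ∈ 𝓝 z, (S ∩ N).Infinite) (n : ℕ) :
    ∃ s : ℕ → X, (∀ i, s i ∈ S) ∧ s 0 ≠ o ∧
      (∀ i j, i < j → j ≤ n → s j ∈ branch o (s i) \ {s i}) ∧
      ∀ x ∈ branch o (s 0) \ branch o (s n), s n ∈ branch o x := by
  obtain ⟨ρ, hρ, hρU⟩ := Metric.nhds_basis_closedBall.mem_iff.1 hzU
  obtain ⟨Y, hY⟩ := exists_finset_meeting_branches (o := o) hρ fun w hw => hU w (hρU hw)
  obtain ⟨V, ⟨hVo, hzV, hVc⟩, hVρ⟩ := (LocallyConnectedSpace.open_connected_basis z).mem_iff.1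
    (Metric.ball_mem_nhds z (show 0 < ρ / 4 by linarith))
  have hVb : closure V ⊆ Metric.ball z (ρ / 2) :=
    (closure_mono hVρ).trans (Metric.closure_ball_subset_closedBall.trans
      (Metric.closedBall_subset_ball (by linarith)))
  let T : Set X := (S ∩ V) \ {o}
  have hT : T.Infinite := (hS V (hVo.mem_nhds hzV)).sdiff (finite_singleton o)
  have := hT.to_subtype
  -- Points with the same trace on `Y` have branches with a common point, so they are comparable.
  let F : T → Set Y := fun x => {y | (y : X) ∈ branch o (x : X)}
  obtain ⟨Y₀, hY₀⟩ := Finite.exists_infinite_fiber F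
  let e : ℕ ↪ (F ⁻¹' {Y₀}) := Infinite.natEmbedding _
  have hne : ∀ x ∈ Metric.ball z (ρ / 2), x ≠ o → ∃ y : Y, (y : X) ∈ branch o x := fun x hx hxo =>
    (hY x hx hxo).elim fun y hy => ⟨⟨y, hy.1⟩, hy.2⟩
  have hfib : ∀ (x : T), F x = Y₀ → ∀ y : Y, (y : X) ∈ branch o (x : X) ↔ y ∈ Y₀ :=
    fun x hx y => hx ▸ Iff.rfl
  have hVball : V ⊆ Metric.ball z (ρ / 2) := subset_closure.trans hVb
  have htot : ∀ x x' : T, F x = Y₀ → F x' = Y₀ →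
      (x : X) ∈ branch o (x' : X) ∨ (x' : X) ∈ branch o (x : X) := by
    intro x x' hx hx'
    obtain ⟨y, hy⟩ := hne x (hVball x.2.1.2) x.2.2
    exact mem_branch_or_mem_branch hy ((hfib x' hx' y).2 ((hfib x hx y).1 hy))
  have hbetween : ∀ a b : T, F a = Y₀ → F b = Y₀ →
      ∀ x ∈ branch o (a : X) \ branch o (b : X), (b : X) ∈ branch o x := by
    intro a b hFa hFb
    have hao : (a : X) ≠ o := a.2.2
    have near : ∀ x ∈ branch o (a : X) \ branch o (b : X), x ∈ Metric.ball z (ρ / 2) →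
        (b : X) ∈ branch o x ∧ x ∈ V := by
      intro x hx hxρ
      obtain ⟨y, hy⟩ := hne x hxρ (ne_of_mem_branch hao hx.1)
      have hyb := (hfib b hFb y).2 ((hfib a hFa y).1 (branch_subset_of_mem hao hx.1 hy))
      have hbx := (mem_branch_or_mem_branch hy hyb).resolve_left hx.2
      refine ⟨hbx, by_contra fun hxV => ?_⟩
      have hax := (hVc.isPreconnected.subset_branch hxV ⟨b, b.2.1.2, hbx⟩ a.2.1.2).1
      exact notMem_branch_of_mem hao hx.1 (fun h => hxV (h ▸ a.2.1.2)) hax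
    intro x hx
    suffices hxV : x ∈ V from (near x hx (hVball hxV)).1
    -- By `near`, the points of `branch o a \ branch o b` in the ball all lie in `V`. Connectedness
    -- of `branch o a` then keeps the rest from lying outside `V`.
    by_contra hxV
    obtain ⟨v, hva, ⟨hvV, hvb⟩, hv⟩ := isPreconnected_closed_iff.1
      (isPreconnected_branch (o := o) (x := (a : X))) (Vᶜ ∩ (branch o (b : X) \ {(b : X)})ᶜ)
      (closure V ∪ branch o (b : X)) (hVo.isClosed_compl.inter isOpen_branch_diff.isClosed_compl)
      (isClosed_closure.union isClosed_branch)
      (fun w _ => by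
        by_cases hwV : w ∈ V
        · exact Or.inr (Or.inl (subset_closure hwV))
        · by_cases hwb : w ∈ branch o (b : X)
          · exact Or.inr (Or.inr hwb)
          · exact Or.inl ⟨hwV, fun h => hwb h.1⟩)
      ⟨x, hx.1, hxV, fun h => hx.2 h.1⟩ ⟨a, self_mem_branch, Or.inl (subset_closure a.2.1.2)⟩
    have hvb' : v ∉ branch o (b : X) := fun h => by
      by_cases hvb' : v = b
      · exact hvV (hvb' ▸ b.2.1.2)
      · exact hvb ⟨h, hvb'⟩
    exact hvV (near v ⟨hva, hvb'⟩ (hVb (hv.resolve_right hvb'))).2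
  let R : T → T → Prop := fun x x' => (x' : X) ∈ branch o (x : X)
  have : IsTrans T R := ⟨fun x _ _ h h' => branch_subset_of_mem x.2.2 h h'⟩
  have hFe : ∀ i, F (e i) = Y₀ := fun i => (e i).2
  have hinj : ∀ i j, ((e i : T) : X) = (e j : T) → i = j := fun i j h =>
    e.injective (Subtype.ext (Subtype.ext h))
  -- Ramsey's theorem for sequences: comparability turns the second alternative into a decreasing
  -- sequence, which is read backwards from `n`.
  obtain ⟨g, hg | hg⟩ := exists_increasing_or_nonincreasing_subseq R fun i => (e i : T)
  · refine ⟨fun i => (e (g i) : T), fun i => (e (g i) : T).2.1.1, (e (g 0) : T).2.2,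
      fun i j hij _ => ⟨hg i j hij, fun h => ?_⟩, hbetween _ _ (hFe _) (hFe _)⟩
    exact hij.ne' (g.injective (hinj _ _ h))
  · refine ⟨fun i => (e (g (n - i)) : T), fun i => (e (g (n - i)) : T).2.1.1,
      (e (g (n - 0)) : T).2.2, fun i j hij hj => ⟨?_, fun h => ?_⟩,
      hbetween _ _ (hFe _) (hFe _)⟩
    · exact (htot _ _ (hFe _) (hFe _)).resolve_right (hg (n - j) (n - i) (by omega))
    · have := g.injective (hinj _ _ h)
      omega

end CutPoints

/-! ### ω-limit sets of powers and of orbits returning to a fixed point -/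

section OmegaLimit

open Set Filter Topology

theorem mem_omegaSet_iff {X : Type*} [TopologicalSpace X] {f : X → X} {x p : X} :
    p ∈ omegaSet f x ↔ MapClusterPt p atTop fun n => f^[n] x :=
  mem_omegaLimit_singleton_iff_mapClusterPt _ _ _ _

/-- An ω-limit set is the union of the ω-limit sets of a power along the first orbit points. -/
theorem exists_mem_omegaSet_iterate {X : Type*} [TopologicalSpace X] {f : X → X} {x p : X}
    (h : p ∈ omegaSet f x) {m : ℕ} (hm : 0 < m) : ∃ i < m, p ∈ omegaSet f^[m] (f^[i] x) := by
  -- An ultrafilter of times concentrates on one residue class modulo `m`.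
  obtain ⟨F, hF, hFp⟩ := mapClusterPt_iff_ultrafilter.1 (mem_omegaSet_iff.1 h)
  have hfin : ∃ i ∈ Finset.range m, {n | n % m = i} ∈ F := by
    refine (Ultrafilter.finite_biUnion_mem_iff (Finset.range m).finite_toSet).1 ?_
    filter_upwards with n
    simpa using Nat.mod_lt n hm
  obtain ⟨i, hi, hiF⟩ := hfin
  refine ⟨i, Finset.mem_range.1 hi, mem_omegaSet_iff.2 (mapClusterPt_iff_ultrafilter.2
    ⟨F.map (· / m), ?_, ?_⟩)⟩
  · exact (Nat.tendsto_div_const_atTop hm.ne').mono_left hF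
  · rw [Ultrafilter.coe_map, tendsto_map'_iff]
    refine hFp.congr' ?_
    filter_upwards [hiF] with n hn
    have hn : n % m = i := hn
    simp only [Function.comp_apply]
    rw [← Function.iterate_mul, ← Function.iterate_add_apply, ← hn, Nat.div_add_mod]

theorem exists_preimage_mem_omegaSet {X : Type*} [TopologicalSpace X] [CompactSpace X] [T2Space X]
    {f g : X → X} (hf : Continuous f) (hfg : Function.Commute f g) {x p : X}
    (h : p ∈ omegaSet g (f x)) : ∃ q ∈ omegaSet g x, f q = p := by
  obtain ⟨F, hF, hFp⟩ := mapClusterPt_iff_ultrafilter.1 (mem_omegaSet_iff.1 h)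
  obtain ⟨q, hq⟩ : ∃ q, Tendsto (fun n => g^[n] x) F (𝓝 q) := by
    obtain ⟨q, -, hq⟩ := isCompact_univ.ultrafilter_le_nhds (F.map fun n => g^[n] x) (by simp)
    exact ⟨q, hq⟩
  refine ⟨q, mem_omegaSet_iff.2 (mapClusterPt_iff_ultrafilter.2 ⟨F, hF, hq⟩),
    tendsto_nhds_unique ((hf.tendsto q).comp hq) (hFp.congr fun n => ?_)⟩
  exact ((hfg.iterate_right n) x).symm

theorem omegaSet_subset_omegaSet_apply {X : Type*} [TopologicalSpace X] (f : X → X) (x : X) :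
    omegaSet f x ⊆ omegaSet f (f x) := by
  intro p hp
  refine mem_omegaSet_iff.2 (mapClusterPt_iff_frequently.2 fun N hN =>
    frequently_atTop.2 fun n => ?_)
  obtain ⟨m, hm, hmN⟩ := frequently_of_mem_omegaSet hp hN (n + 1)
  obtain ⟨k, rfl⟩ := Nat.exists_eq_add_of_le' (show 1 ≤ m by omega)
  exact ⟨k, by omega, hmN⟩

/-- An ω-limit set is covered by images of any one of the ω-limit sets of a power along the
first orbit points. -/
theorem omegaSet_subset_iUnion_image {X : Type*} [TopologicalSpace X] [CompactSpace X]
    [T2Space X] {f : X → X} (hf : Continuous f) {x : X} {m i : ℕ} (hi : i < m) :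
    omegaSet f x ⊆ ⋃ j ∈ Finset.range m, f^[j + (m - i)] '' omegaSet f^[m] (f^[i] x) := by
  intro q hq
  obtain ⟨j, hj, hqj⟩ := exists_mem_omegaSet_iterate hq (by omega : 0 < m)
  refine mem_iUnion₂.2 ⟨j, Finset.mem_range.2 hj, ?_⟩
  -- One more application of `f^[m]` ensures that the starting point `f^[m + j] x` comes after
  -- `f^[i] x`, even when `j < i`.
  have hq' := omegaSet_subset_omegaSet_apply _ _ hqj
  rw [← Function.iterate_add_apply, show m + j = j + (m - i) + i by omega,
    Function.iterate_add_apply] at hq'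
  exact exists_preimage_mem_omegaSet (hf.iterate _)
    ((Function.Commute.refl f).iterate_iterate _ _) hq'

/-- A fixed point of `f` in an infinite ω-limit set is not isolated in it. -/
theorem infinite_inter_of_fixed {X : Type*} [MetricSpace X] [CompactSpace X]
    {f : X → X} (hf : Continuous f) {p y : X} (hp : f p = p) (hpω : p ∈ omegaSet f y)
    (hinf : (omegaSet f y).Infinite) {N : Set X} (hN : N ∈ 𝓝 p) :
    (omegaSet f y ∩ N).Infinite := by
  intro hfin
  have hN' : N ∩ ((omegaSet f y ∩ N) \ {p})ᶜ ∈ 𝓝 p := inter_mem hN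
    ((hfin.subset sdiff_subset).isClosed.isOpen_compl.mem_nhds fun h => h.2 rfl)
  obtain ⟨ε, hε, hεN⟩ := Metric.nhds_basis_closedBall.mem_iff.1 hN'
  have hiso : ∀ q ∈ omegaSet f y, q ∈ Metric.closedBall p ε → q = p := fun q hq hqε =>
    by_contra fun hne => (hεN hqε).2 ⟨⟨hq, (hεN hqε).1⟩, hne⟩
  obtain ⟨δ, hδ, hδε⟩ := Metric.continuousAt_iff.1 (hf.continuousAt (x := p)) ε hε
  rw [hp] at hδε
  -- The annulus contains no limit point, so the orbit eventually avoids it; from inside the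
  -- `δ`-ball one step cannot jump over it. The orbit is trapped near `p`, and `p` is its only limit
  -- point.
  have hev : ∀ᶠ n in atTop, f^[n] y ∈ (Metric.closedBall p ε \ Metric.ball p δ)ᶜ := by
    have := eventually_mapsTo_of_isOpen_of_omegaLimit_subset atTop
      (fun (n : ℕ) (y : X) => f^[n] y) {y}
      (Metric.isClosed_closedBall.sdiff Metric.isOpen_ball).isOpen_compl
      (v := (Metric.closedBall p ε \ Metric.ball p δ)ᶜ) (fun q hq hq' => hq'.2 (by
        rw [hiso q hq hq'.1]
        exact Metric.mem_ball_self hδ))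
    simpa using this
  obtain ⟨n₀, hn₀⟩ := eventually_atTop.1 hev
  obtain ⟨n, hn, hnδ⟩ := frequently_of_mem_omegaSet hpω
    (Metric.ball_mem_nhds p (lt_min hε hδ)) n₀
  have hstay : ∀ k, n ≤ k → f^[k] y ∈ Metric.closedBall p ε ∩ Metric.ball p δ := by
    intro k hk
    induction k, hk using Nat.le_induction with
    | base =>
      exact ⟨Metric.ball_subset_closedBall (Metric.ball_subset_ball (min_le_left _ _) hnδ),
        Metric.ball_subset_ball (min_le_right _ _) hnδ⟩
    | succ k hk ih =>
      have hε' : f^[k + 1] y ∈ Metric.closedBall p ε := by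
        rw [Function.iterate_succ_apply']
        exact (hδε ih.2).le
      exact ⟨hε', by_contra fun h => hn₀ (k + 1) (by omega) ⟨hε', h⟩⟩
  refine hinf ((finite_singleton p).subset fun q hq => hiso q hq ?_)
  by_contra hqε
  obtain ⟨k, hk, hkq⟩ := frequently_of_mem_omegaSet hq
    (Metric.isClosed_closedBall.isOpen_compl.mem_nhds hqε) n
  exact hkq (hstay k hk).1

end OmegaLimit

/-! ### Endpoints, condensation points and the conclusion -/

section Dendrite

open Set Filter Topology

/-- In a space with more than one point, a point that is not an endpoint is a cut point. -/
theorem not_isPreconnected_compl_of_notMem_endpoints {X : Type*} [TopologicalSpace X] [Nontrivial X]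
    {w : X} (hw : w ∉ endpoints X) : ¬ IsPreconnected ({w}ᶜ : Set X) := by
  intro hc
  refine hw ?_
  change ENat.card (ConnectedComponents ({w}ᶜ : Set X)) = 1
  have := isPreconnected_iff_preconnectedSpace.1 hc
  obtain ⟨v, hv⟩ := exists_ne w
  have : Nonempty ({w}ᶜ : Set X) := ⟨⟨v, hv⟩⟩
  rw [ENat.card_eq_one_iff_unique]
  have : Nonempty (ConnectedComponents ({w}ᶜ : Set X)) := inferInstance
  exact ⟨Unique.mk ⟨Classical.arbitrary _⟩ fun _ => Subsingleton.elim _ _⟩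

/-- The situation excluded by zero entropy: an ω-limit set which contains a periodic point and
accumulates at a point near which all points are cut points. -/
theorem hasHorseshoe_of_periodic_of_cut {X : Type*} [MetricSpace X] [CompactSpace X]
    [PreconnectedSpace X] [LocallyConnectedSpace X] {f : X → X} (hf : Continuous f) {p y z : X}
    {m : ℕ} (hm : 0 < m) (hp : f^[m] p = p) (hpω : p ∈ omegaSet f^[m] y) {U : Set X}
    (hzU : U ∈ 𝓝 z) (hU : ∀ w ∈ U, w ≠ p → ¬ IsPreconnected ({w}ᶜ : Set X))
    (hz : ∀ N ∈ 𝓝 z, (omegaSet f^[m] y ∩ N).Infinite) : HasHorseshoe f := by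
  obtain ⟨s, hsω, hs₀, hs, hbetween⟩ := exists_chain_of_cut hzU hU hz 16
  exact HasHorseshoe.of_iterate hm
    (hasHorseshoe_of_chain (hf.iterate m) hs₀ hs hbetween hp hpω hsω)

/-- An uncountable set contains one of its condensation points. -/
theorem exists_mem_forall_nhds_not_countable {X : Type*} [TopologicalSpace X]
    [SecondCountableTopology X] {T : Set X} (hT : ¬ T.Countable) :
    ∃ z ∈ T, ∀ N ∈ 𝓝 z, ¬ (T ∩ N).Countable := by
  by_contra! h
  choose! N hN hc using h
  obtain ⟨t, htT, ht, hcov⟩ := TopologicalSpace.countable_cover_nhdsWithin (f := N) (s := T)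
    fun x hx => mem_nhdsWithin_of_mem_nhds (hN x hx)
  refine hT ((ht.biUnion fun x hx => hc x (htT hx)).mono fun x hx => ?_)
  obtain ⟨w, hw, hxw⟩ := mem_iUnion₂.1 (hcov hx)
  exact mem_iUnion₂.2 ⟨w, hw, hx, hxw⟩

end Dendrite

theorem theoremA {X : Type*} [MetricSpace X] (hX : IsDendrite X)
    (hE : IsClosed (endpoints X)) (f : X → X) (hf : Continuous f)
    (hent : Dynamics.coverEntropy f (Set.univ : Set X) = 0) (x : X) :
    ((omegaSet f x).Infinite →
      omegaSet f x ∩ Function.periodicPts f ⊆ derivedSet (endpoints X)) ∧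
    ((endpoints X).Countable → ¬ (omegaSet f x).Countable →
      omegaSet f x ∩ Function.periodicPts f = ∅) := by
  have := hX.compact
  have := hX.connected
  have := hX.locallyConnected
  have hno : ¬ HasHorseshoe f := fun h => h.coverEntropy_ne_zero hent
  constructor
  · rintro hinf p ⟨hpω, m, hm, hmp⟩
    have : Nontrivial X := Set.nontrivial_of_nontrivial hinf.nontrivial
    obtain ⟨i, hi, hpi⟩ := exists_mem_omegaSet_iterate hpω hm
    have hinf' : (omegaSet f^[m] (f^[i] x)).Infinite := fun hfin =>
      hinf (((Finset.finite_toSet _).biUnion fun j _ => hfin.image _).subset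
        (omegaSet_subset_iUnion_image hf hi))
    by_contra hp
    rw [mem_derivedSet, accPt_iff_nhds] at hp
    push Not at hp
    -- Here `z = p`: the neighbourhood `U` has no endpoint except possibly `p` itself.
    obtain ⟨U, hU, hUE⟩ := hp
    exact hno (hasHorseshoe_of_periodic_of_cut hf hm hmp hpi hU
      (fun w hw hwp => not_isPreconnected_compl_of_notMem_endpoints
        fun hwE => hwp (hUE w ⟨hw, hwE⟩))
      fun N hN => infinite_inter_of_fixed (hf.iterate m) hmp hpi hinf' hN)
  · rintro hEc hunc
    refine Set.eq_empty_iff_forall_notMem.2 ?_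
    rintro p ⟨hpω, m, hm, hmp⟩
    obtain ⟨i, hi, hpi⟩ := exists_mem_omegaSet_iterate hpω hm
    have hunc' : ¬ (omegaSet f^[m] (f^[i] x)).Countable := fun hc =>
      hunc (((Finset.countable_toSet _).biUnion fun j _ => hc.image _).mono
        (omegaSet_subset_iUnion_image hf hi))
    have : Nontrivial X := Set.nontrivial_of_nontrivial
      (Set.Infinite.nontrivial fun h => hunc' h.countable)
    -- Removing countably many endpoints leaves an uncountable set, and closedness of `endpoints X`
    -- gives its condensation point `z` a neighbourhood of cut points.
    obtain ⟨z, hz, hzc⟩ := exists_mem_forall_nhds_not_countable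
      (T := omegaSet f^[m] (f^[i] x) \ endpoints X) fun h =>
        hunc' ((h.union hEc).mono fun w hw => by
          by_cases hwE : w ∈ endpoints X
          exacts [Or.inr hwE, Or.inl ⟨hw, hwE⟩])
    exact hno (hasHorseshoe_of_periodic_of_cut hf hm hmp hpi (hE.isOpen_compl.mem_nhds hz.2)
      (fun w hw _ => not_isPreconnected_compl_of_notMem_endpoints hw)
      fun N hN hfin => hzc N hN
        (hfin.subset (Set.inter_subset_inter_left _ Set.sdiff_subset)).countable)
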